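/- Let an MV-algebra be an algebra $\langle M,\oplus,\neg,0\rangle$ of type $(2,1,0)$ satisfying $x\oplus(y\oplus z)=(x\oplus y)\oplus z$, $x\oplus y=y\oplus x$, $x\oplus 0=x$, $\neg\neg x=x$, $x\oplus\neg 0=\neg 0$ and $\neg(\neg x\oplus y)\oplus y=\neg(\neg y\oplus x)\oplus x$. Let $\mathcal{MV}_f$ be the class of finite nontrivial MV-algebras (those with more than one element). Let $C\subseteq\mathbb{R}$ be the Cantor set with the subspace topology, and consider $[0,1]^C$ with the pointwise operations $x\oplus y=\min\{x+y,1\}$, $\neg x=1-x$ and the constant $0$. Let $A\subseteq[0,1]^C$ be the set of all finite joins $\bigvee_{i=1}^n q_i\cdot 1_{U_i}$ (pointwise maxima; the empty join is $0$) with $n\ge 0$, $q_i\in[0,1]\cap\mathbb{Q}$ and $U_i\subseteq C$ clopen; $A$ is closed under the operations. Then $\mathcal{MV}_f$ is a Fraïssé class (nonempty, consisting of finitely generated structures, essentially countable, hereditary, with the joint embedding and the amalgamation property), and its Fraïssé limit is isomorphic to $A$. In detail: $A$ is a countably infinite, locally finite MV-algebra; $A$ is ultrahomogeneous (every isomorphism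 between finitely generated subalgebras of $A$ extends to an automorphism of $A$); the finitely generated structures that embed in $A$ are exactly the members of $\mathcal{MV}_f$; and a countable structure $M$ of type $(2,1,0)$ is a Fraïssé limit of $\mathcal{MV}_f$ (that is, $M$ is ultrahomogeneous and the finitely generated structures embeddable in $M$ are exactly the members of $\mathcal{MV}_f$) if and only if $M\cong A$. -/

import Mathlib

open FirstOrder FirstOrder.Language

universe u

/-- Function symbols of the signature `⟨⊕, ¬, 0⟩` of type `(2, 1, 0)`. -/
inductive MVFunc : ℕ → Type
  | oplus : MVFunc 2
  | neg : MVFunc 1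
  | zero : MVFunc 0

/-- The (purely algebraic) first-order language of MV-algebras. -/
def mvLang : FirstOrder.Language.{0, 0} := ⟨MVFunc, fun _ => Empty⟩

instance mvLang_countable : Countable (Σ l, mvLang.Functions l) := by
  have h : Function.Injective
      (fun s : (Σ l, MVFunc l) => (s.1 : ℕ)) := by
    rintro ⟨_, f⟩ ⟨_, g⟩ hfg
    cases f <;> cases g <;> simp_all
  exact h.countable

/-- `x ⊕ y` in a structure of the language of MV-algebras. -/
def mvAdd {M : Type u} [mvLang.Structure M] (x y : M) : M :=
  Structure.funMap (L := mvLang) MVFunc.oplus ![x, y]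

/-- `¬ x` in a structure of the language of MV-algebras. -/
def mvNeg {M : Type u} [mvLang.Structure M] (x : M) : M :=
  Structure.funMap (L := mvLang) MVFunc.neg ![x]

/-- The constant `0` in a structure of the language of MV-algebras. -/
def mvZero (M : Type u) [mvLang.Structure M] : M :=
  Structure.funMap (L := mvLang) MVFunc.zero ![]

/-- A structure `⟨M, ⊕, ¬, 0⟩` is an MV-algebra. -/
structure IsMVAlgebra (M : Type u) [mvLang.Structure M] : Prop where
  add_assoc : ∀ x y z : M, mvAdd x (mvAdd y z) = mvAdd (mvAdd x y) z
  add_comm : ∀ x y : M, mvAdd x y = mvAdd y x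
  add_zero : ∀ x : M, mvAdd x (mvZero M) = x
  neg_neg : ∀ x : M, mvNeg (mvNeg x) = x
  add_one : ∀ x : M, mvAdd x (mvNeg (mvZero M)) = mvNeg (mvZero M)
  lukasiewicz : ∀ x y : M,
    mvAdd (mvNeg (mvAdd (mvNeg x) y)) y = mvAdd (mvNeg (mvAdd (mvNeg y) x)) x

/-- The class of finite MV-algebras. As usual in this context an MV-algebra is nontrivial, i.e.
`0 ≠ 1`: the one-element algebra has no common extension with any other MV-algebra. -/
def finiteMVAlgebras : Set (CategoryTheory.Bundled.{u} mvLang.Structure) :=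
  {M | IsMVAlgebra M ∧ Finite M ∧ Nontrivial M}

/-- `[0,1]^X` with the pointwise operations `x ⊕ y = min (x + y) 1`, `¬ x = 1 - x`, and `0`. -/
noncomputable instance fuzzyStructure (X : Type) : mvLang.Structure (X → unitInterval) where
  funMap
    | MVFunc.oplus, v => fun x =>
        ⟨min ((v 0 x : ℝ) + v 1 x) 1,
          le_min (add_nonneg (v 0 x).2.1 (v 1 x).2.1) zero_le_one, min_le_right _ _⟩
    | MVFunc.neg, v => fun x => unitInterval.symm (v 0 x)
    | MVFunc.zero, _ => fun _ => 0
  RelMap r := Empty.elim r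

/-- The finite joins of fuzzy sets `q · 1_U`, for `q ∈ [0,1] ∩ ℚ` and `U` a clopen subset of the
Cantor set (as a subspace of `ℝ`). -/
def stepFuzzySets : Set (cantorSet → unitInterval) :=
  {f | ∃ (n : ℕ) (q : Fin n → unitInterval) (U : Fin n → Set cantorSet),
    (∀ i, (∃ r : ℚ, (q i : ℝ) = r) ∧ IsClopen (U i)) ∧
      f = Finset.univ.sup fun i => (U i).indicator fun _ => q i}

theorem mem_stepFuzzySets_iff (f : cantorSet → unitInterval) :
    f ∈ stepFuzzySets ↔ IsLocallyConstant f ∧ ∀ x, ∃ r : ℚ, (f x : ℝ) = r := by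
  classical
  constructor
  · rintro ⟨n, q, U, h, rfl⟩
    refine Finset.sup_induction
      (p := fun f : cantorSet → unitInterval =>
        IsLocallyConstant f ∧ ∀ x, ∃ r : ℚ, (f x : ℝ) = r) ?_ ?_ ?_
    · exact ⟨IsLocallyConstant.const _, fun x => ⟨0, by simp⟩⟩
    · rintro f ⟨hf, hf'⟩ g ⟨hg, hg'⟩
      refine ⟨hf.comp₂ hg (fun a b => a ⊔ b), fun x => ?_⟩
      rcases le_total (f x) (g x) with hle | hle
      · simpa [sup_eq_right.2 hle] using hg' x
      · simpa [sup_eq_left.2 hle] using hf' x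
    · intro i _
      refine ⟨?_, fun x => ?_⟩
      · refine (IsLocallyConstant.iff_exists_open _).2 fun x => ?_
        by_cases hx : x ∈ U i
        · exact ⟨U i, (h i).2.isOpen, hx, fun y hy => by simp [hx, hy]⟩
        · exact ⟨(U i)ᶜ, (h i).2.compl.isOpen, hx, fun y hy => by
            have hy' : y ∉ U i := hy
            simp [hx, hy']⟩
      · by_cases hx : x ∈ U i
        · simpa [hx] using (h i).1
        · exact ⟨0, by simp [hx]⟩
  · rintro ⟨hf, hr⟩
    have : CompactSpace cantorSet := isCompact_iff_compactSpace.1 isCompact_cantorSet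
    have hfin : (Set.range f).Finite := hf.range_finite
    have : Finite (Set.range f) := hfin
    obtain ⟨n, ⟨e⟩⟩ := Finite.exists_equiv_fin (Set.range f)
    refine ⟨n, fun i => (e.symm i : unitInterval), fun i => f ⁻¹' {(e.symm i : unitInterval)},
      fun i => ⟨?_, hf.isClopen_fiber _⟩, ?_⟩
    · obtain ⟨x, hx⟩ := (e.symm i).2
      simpa [hx] using hr x
    · funext x
      rw [Finset.sup_apply]
      apply le_antisymm
      · refine le_trans ?_ (Finset.le_sup (Finset.mem_univ (e ⟨f x, x, rfl⟩)))
        simp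
      · refine Finset.sup_le fun i _ => ?_
        by_cases hx : f x = (e.symm i : unitInterval)
        · simp [Set.indicator, hx]
        · simp [Set.indicator, hx]

/-- The algebra `A` of rational-valued clopen step functions on the Cantor set, a subalgebra of
the MV-algebra of all fuzzy subsets of the Cantor set. -/
def stepAlgebra : mvLang.Substructure (cantorSet → unitInterval) where
  carrier := stepFuzzySets
  fun_mem {n} g := by
    cases g with
    | oplus =>
      intro v hv
      obtain ⟨h0, h0'⟩ := (mem_stepFuzzySets_iff _).1 (hv 0)
      obtain ⟨h1, h1'⟩ := (mem_stepFuzzySets_iff _).1 (hv 1)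
      refine (mem_stepFuzzySets_iff _).2 ⟨?_, fun x => ?_⟩
      · exact h0.comp₂ h1 (fun a b : unitInterval =>
          (⟨min ((a : ℝ) + b) 1, le_min (add_nonneg a.2.1 b.2.1) zero_le_one,
            min_le_right _ _⟩ : unitInterval))
      · obtain ⟨r, hr⟩ := h0' x
        obtain ⟨s, hs⟩ := h1' x
        refine ⟨min (r + s) 1, ?_⟩
        change min ((v 0 x : ℝ) + v 1 x) 1 = _
        rw [hr, hs]
        push_cast
        rfl
    | neg =>
      intro v hv
      obtain ⟨h0, h0'⟩ := (mem_stepFuzzySets_iff _).1 (hv 0)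
      refine (mem_stepFuzzySets_iff _).2 ⟨h0.comp unitInterval.symm, fun x => ?_⟩
      obtain ⟨r, hr⟩ := h0' x
      refine ⟨1 - r, ?_⟩
      change 1 - (v 0 x : ℝ) = _
      rw [hr]
      push_cast
      rfl
    | zero =>
      intro v _
      refine (mem_stepFuzzySets_iff _).2 ⟨IsLocallyConstant.const (0 : unitInterval), fun x => ?_⟩
      exact ⟨0, by change ((0 : unitInterval) : ℝ) = _; simp⟩

/-!
Let `N` be a finite MV-algebra. Its homomorphisms to `[0,1]` are finite in number and separate the
points of `N`, and no proper subset of them separates points. Hence an embedding of `N` into the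
algebra `A` of step functions is the same thing as a locally constant surjection from the Cantor
set onto `Hom(N, [0,1])`, namely evaluation of step functions. Extending an embedding along `M ↪
N` thus means lifting a locally constant surjection onto `Hom(M, [0,1])` along the surjective
restriction map `Hom(N, [0,1]) → Hom(M, [0,1])`. This is always possible because every nonempty
clopen subset of the Cantor set is infinite, so it has a locally constant map onto any nonempty
finite set. It follows that `A` is ultrahomogeneous with age the finite MV-algebras.

To separate the points of `N`, one counts, for an atom `e`, how many times `e` fits into an
element: scaled by its maximum, this count is a homomorphism to `[0,1]`. Local finiteness of `A`
holds because finitely many step functions take finitely many rational values, with a common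
denominator.
-/

section OrderedMonoid

variable {M : Type*} [AddCommMonoid M] [PartialOrder M]

/-- The first `n` at which the sequence `0, e, 2e, …` becomes constant; it is `0` if the sequence
never stabilizes. -/
noncomputable def saturationIndex (e : M) : ℕ :=
  sInf {n | (n + 1) • e ≤ n • e}

open scoped Classical in
/-- The number of times `e` fits into `x`, truncated at the saturation index of `e`. For an atom `e`
of a finite MV-algebra this is, up to scaling, a homomorphism to `[0,1]`. -/
noncomputable def nsmulHeight (e x : M) : ℕ :=
  Nat.findGreatest (fun k => k • e ≤ x) (saturationIndex e)

theorem nsmulHeight_le (e x : M) : nsmulHeight e x ≤ saturationIndex e := by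
  classical exact Nat.findGreatest_le _

/-- The height of `x` relative to the saturation index of `e`; it is `0` if the latter is `0`. -/
noncomputable def normalizedHeight (e x : M) : unitInterval :=
  ⟨nsmulHeight e x / saturationIndex e, unitInterval.div_mem (Nat.cast_nonneg _) (Nat.cast_nonneg _)
    (Nat.cast_le.2 (nsmulHeight_le e x))⟩

theorem coe_normalizedHeight (e x : M) :
    (normalizedHeight e x : ℝ) = nsmulHeight e x / saturationIndex e :=
  rfl

theorem le_nsmulHeight {e x : M} {k : ℕ} (hk : k ≤ saturationIndex e) (h : k • e ≤ x) :
    k ≤ nsmulHeight e x := by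
  classical exact Nat.le_findGreatest hk h

variable [CanonicallyOrderedAdd M]

theorem nsmul_le_nsmul_of_le {m n : ℕ} (h : m ≤ n) (e : M) : m • e ≤ n • e :=
  have := CanonicallyOrderedAdd.toIsOrderedAddMonoid (α := M)
  nsmul_le_nsmul_left zero_le h

theorem le_of_nsmul_le_nsmul {e : M} {j k : ℕ} (hj : j ≤ saturationIndex e)
    (h : j • e ≤ k • e) : j ≤ k := by
  by_contra! hkj
  have : saturationIndex e ≤ k := Nat.sInf_le ((nsmul_le_nsmul_of_le hkj e).trans h)
  omega

theorem succ_saturationIndex_nsmul_le [Finite M] (e : M) :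
    (saturationIndex e + 1) • e ≤ saturationIndex e • e := by
  refine Nat.sInf_mem (s := {n | (n + 1) • e ≤ n • e}) ?_
  by_contra! hempty
  have hmono : StrictMono fun k : ℕ => k • e := strictMono_nat_of_lt_succ fun k =>
    (nsmul_le_nsmul_of_le k.le_succ e).lt_of_not_ge (Set.eq_empty_iff_forall_notMem.1 hempty k)
  exact not_injective_infinite_finite _ hmono.injective

theorem nsmul_le_saturationIndex_nsmul [Finite M] (e : M) (m : ℕ) :
    m • e ≤ saturationIndex e • e := by
  have := CanonicallyOrderedAdd.toIsOrderedAddMonoid (α := M)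
  induction m with
  | zero => simp
  | succ m ih =>
    calc (m + 1) • e = m • e + e := succ_nsmul e m
      _ ≤ saturationIndex e • e + e := by gcongr
      _ = (saturationIndex e + 1) • e := (succ_nsmul e _).symm
      _ ≤ saturationIndex e • e := succ_saturationIndex_nsmul_le e

theorem saturationIndex_pos [Finite M] {e : M} (he : 0 < e) : 0 < saturationIndex e := by
  by_contra! h
  have := nsmul_le_saturationIndex_nsmul e 1
  rw [Nat.le_zero.1 h, one_nsmul, zero_nsmul] at this
  exact he.not_ge this

theorem nsmulHeight_nsmul_le (e x : M) : nsmulHeight e x • e ≤ x := by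
  classical
  have h0 : (0 : ℕ) • e ≤ x := by simp
  unfold nsmulHeight
  exact Nat.findGreatest_spec (P := fun k : ℕ => k • e ≤ x) (Nat.zero_le _) h0

theorem nsmulHeight_pos [Finite M] {e x : M} (he : 0 < e) (hx : e ≤ x) : 0 < nsmulHeight e x :=
  le_nsmulHeight (saturationIndex_pos he) (by simpa using hx)

theorem nsmulHeight_zero (e : M) : nsmulHeight e 0 = 0 :=
  Nat.le_zero.1 <| le_of_nsmul_le_nsmul (nsmulHeight_le e 0) <| by
    simpa using nsmulHeight_nsmul_le e 0

variable [Sub M] [OrderedSub M] {e : M}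

theorem eq_nsmul_of_le_nsmul (he : 0 ⋖ e) {n : ℕ} {x : M} (hx : x ≤ n • e) :
    ∃ k ≤ n, x = k • e := by
  induction n generalizing x with
  | zero => exact ⟨0, le_rfl, by simpa using hx⟩
  | succ n ih =>
    obtain ⟨k, hk, hxk⟩ := ih (x := x - e) (by rwa [tsub_le_iff_right, ← succ_nsmul])
    rcases he.eq_or_eq zero_le (tsub_tsub_le (a := e) (b := x)) with h | h
    · exact ⟨k, by omega, hxk ▸ (tsub_eq_zero_iff_le.1 h).antisymm tsub_le_self⟩
    · have hex : e ≤ x := h ▸ tsub_le_self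
      exact ⟨k + 1, by omega, by rw [succ_nsmul, ← hxk, tsub_add_cancel_of_le hex]⟩

theorem le_nsmulHeight_nsmul (he : 0 ⋖ e) {t x : M} (htx : t ≤ x)
    (ht : t ≤ saturationIndex e • e) : t ≤ nsmulHeight e x • e := by
  obtain ⟨k, hk, rfl⟩ := eq_nsmul_of_le_nsmul he ht
  exact nsmul_le_nsmul_of_le (le_nsmulHeight hk htx) e

theorem nsmulHeight_add [Finite M] (he : 0 ⋖ e) (x y : M) :
    nsmulHeight e (x + y) = min (nsmulHeight e x + nsmulHeight e y) (saturationIndex e) := by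
  have := CanonicallyOrderedAdd.toIsOrderedAddMonoid (α := M)
  refine le_antisymm (le_min ?_ (nsmulHeight_le _ _)) (le_nsmulHeight (min_le_right _ _) ?_)
  · have hsat := nsmul_le_saturationIndex_nsmul e (nsmulHeight e (x + y))
    have hx : nsmulHeight e (x + y) • e - y ≤ nsmulHeight e x • e :=
      le_nsmulHeight_nsmul he (tsub_le_iff_right.2 (nsmulHeight_nsmul_le e _))
        (tsub_le_self.trans hsat)
    have hy : nsmulHeight e (x + y) • e - nsmulHeight e x • e ≤ nsmulHeight e y • e :=
      le_nsmulHeight_nsmul he (tsub_le_iff_tsub_le.1 hx) (tsub_le_self.trans hsat)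
    refine le_of_nsmul_le_nsmul (nsmulHeight_le _ _) ?_
    rw [add_nsmul]
    exact tsub_le_iff_left.1 hy
  · calc min (nsmulHeight e x + nsmulHeight e y) (saturationIndex e) • e
        ≤ (nsmulHeight e x + nsmulHeight e y) • e := nsmul_le_nsmul_of_le (min_le_left _ _) e
      _ = nsmulHeight e x • e + nsmulHeight e y • e := add_nsmul _ _ _
      _ ≤ x + y := add_le_add (nsmulHeight_nsmul_le e x) (nsmulHeight_nsmul_le e y)

variable [OrderTop M]

theorem add_right_cancel_of_le_top_sub (hinv : Function.Involutive fun x : M => ⊤ - x)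
    {u v w : M} (hu : u ≤ ⊤ - w) (hv : v ≤ ⊤ - w) (h : u + w = v + w) : u = v := by
  have key {t : M} (ht : t ≤ ⊤ - w) : ⊤ - (t + w) + w = ⊤ - t := by
    have hw : w ≤ ⊤ - t := by simpa only [hinv w] using tsub_le_tsub_left ht ⊤
    rw [← tsub_tsub, tsub_add_cancel_of_le hw]
  exact hinv.injective (by simp only [← key hu, ← key hv, h])

theorem nsmulHeight_top_sub [Finite M] (hinv : Function.Involutive fun x : M => ⊤ - x)
    (he : 0 ⋖ e) (x : M) : nsmulHeight e (⊤ - x) = saturationIndex e - nsmulHeight e x := by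
  set n := saturationIndex e
  set k := nsmulHeight e x
  have hk : k ≤ n := nsmulHeight_le e x
  have hge : n - k ≤ nsmulHeight e (⊤ - x) := by
    have hadd := nsmulHeight_add he (⊤ - x) x
    have htop : n ≤ nsmulHeight e ⊤ := le_nsmulHeight le_rfl le_top
    rw [tsub_add_cancel_of_le le_top] at hadd
    omega
  refine le_antisymm ?_ hge
  by_contra! hlt
  have hfit : (n - k + 1) • e ≤ ⊤ - k • e :=
    calc (n - k + 1) • e ≤ nsmulHeight e (⊤ - x) • e := nsmul_le_nsmul_of_le hlt e
      _ ≤ ⊤ - x := nsmulHeight_nsmul_le e _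
      _ ≤ ⊤ - k • e := tsub_le_tsub_left (nsmulHeight_nsmul_le e x) ⊤
  have hle : (n - k) • e ≤ (n - k + 1) • e := nsmul_le_nsmul_of_le (Nat.le_succ _) e
  have hsat : (n - k) • e + k • e = (n - k + 1) • e + k • e := by
    rw [← add_nsmul, ← add_nsmul, Nat.sub_add_cancel hk, Nat.add_right_comm,
      Nat.sub_add_cancel hk]
    exact (nsmul_le_nsmul_of_le n.le_succ e).antisymm (succ_saturationIndex_nsmul_le e)
  have heq := add_right_cancel_of_le_top_sub hinv (hle.trans hfit) hfit hsat
  have := le_of_nsmul_le_nsmul (hlt.trans_le (nsmulHeight_le e _)) heq.ge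
  omega

end OrderedMonoid

section Language

instance mvLang_isAlgebraic : mvLang.IsAlgebraic :=
  fun _ => inferInstanceAs (IsEmpty Empty)

variable {M N : Type*} [mvLang.Structure M] [mvLang.Structure N]

theorem funMap_oplus (v : Fin 2 → M) :
    Structure.funMap (L := mvLang) MVFunc.oplus v = mvAdd (v 0) (v 1) :=
  congrArg _ (List.ofFn_injective rfl)

theorem funMap_neg (v : Fin 1 → M) :
    Structure.funMap (L := mvLang) MVFunc.neg v = mvNeg (v 0) :=
  congrArg _ (List.ofFn_injective rfl)

theorem funMap_zero (v : Fin 0 → M) :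
    Structure.funMap (L := mvLang) MVFunc.zero v = mvZero M :=
  congrArg _ (Subsingleton.elim _ _)

section HomClass

variable {F : Type*} [FunLike F M N] [mvLang.HomClass F M N]

theorem map_mvAdd (f : F) (x y : M) : f (mvAdd x y) = mvAdd (f x) (f y) :=
  (HomClass.map_fun (L := mvLang) f MVFunc.oplus ![x, y]).trans (funMap_oplus _)

theorem map_mvNeg (f : F) (x : M) : f (mvNeg x) = mvNeg (f x) :=
  (HomClass.map_fun (L := mvLang) f MVFunc.neg ![x]).trans (funMap_neg _)

theorem map_mvZero (f : F) : f (mvZero M) = mvZero N :=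
  (HomClass.map_fun (L := mvLang) f MVFunc.zero ![]).trans (funMap_zero _)

end HomClass

/-- A map preserving `⊕`, `¬` and `0`, as a homomorphism of structures. -/
def mvHom (f : M → N) (map_add : ∀ x y, f (mvAdd x y) = mvAdd (f x) (f y))
    (map_neg : ∀ x, f (mvNeg x) = mvNeg (f x)) (map_zero : f (mvZero M) = mvZero N) :
    M →[mvLang] N where
  toFun := f
  map_fun' g v := by
    cases g with
    | oplus =>
      exact (congrArg f (funMap_oplus v)).trans ((map_add _ _).trans (funMap_oplus (f ∘ v)).symm)
    | neg => exact (congrArg f (funMap_neg v)).trans ((map_neg _).trans (funMap_neg (f ∘ v)).symm)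
    | zero => exact (congrArg f (funMap_zero v)).trans (map_zero.trans (funMap_zero (f ∘ v)).symm)
  map_rel' r := r.elim

theorem IsMVAlgebra.of_injective (hN : IsMVAlgebra N) {ι : Type*} (f : ι → M →[mvLang] N)
    (hf : Function.Injective fun x i => f i x) : IsMVAlgebra M where
  add_assoc x y z := hf <| funext fun i => by simp only [map_mvAdd, hN.add_assoc]
  add_comm x y := hf <| funext fun i => by simp only [map_mvAdd, hN.add_comm (f i x)]
  add_zero x := hf <| funext fun i => by simp only [map_mvAdd, map_mvZero, hN.add_zero]
  neg_neg x := hf <| funext fun i => by simp only [map_mvNeg, hN.neg_neg]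
  add_one x := hf <| funext fun i => by
    simp only [map_mvAdd, map_mvNeg, map_mvZero, hN.add_one]
  lukasiewicz x y := hf <| funext fun i => by
    simp only [map_mvAdd, map_mvNeg, hN.lukasiewicz (f i x)]

end Language

section UnitInterval

/-- The standard MV-algebra `[0,1]`, with `x ⊕ y = min (x + y) 1` and `¬ x = 1 - x`. -/
noncomputable instance unitIntervalStructure : mvLang.Structure unitInterval where
  funMap
    | MVFunc.oplus, v =>
        ⟨min ((v 0 : ℝ) + v 1) 1, le_min (add_nonneg (v 0).2.1 (v 1).2.1) zero_le_one,
          min_le_right _ _⟩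
    | MVFunc.neg, v => unitInterval.symm (v 0)
    | MVFunc.zero, _ => 0
  RelMap r := Empty.elim r

theorem coe_mvAdd (a b : unitInterval) :
    ((mvAdd a b : unitInterval) : ℝ) = min ((a : ℝ) + b) 1 := rfl

theorem coe_mvNeg (a : unitInterval) : ((mvNeg a : unitInterval) : ℝ) = 1 - a := rfl

theorem coe_mvZero : ((mvZero unitInterval : unitInterval) : ℝ) = 0 := rfl

theorem coe_mvAdd_mvNeg_mvAdd_mvNeg (a b : unitInterval) :
    ((mvAdd (mvNeg (mvAdd (mvNeg a) b)) b : unitInterval) : ℝ) = max (a : ℝ) b := by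
  rw [coe_mvAdd, coe_mvNeg, coe_mvAdd, coe_mvNeg]
  grind

theorem isMVAlgebra_unitInterval : IsMVAlgebra unitInterval where
  add_assoc a b c := Subtype.ext <| by simp only [coe_mvAdd]; grind
  add_comm a b := Subtype.ext <| by simp only [coe_mvAdd, add_comm]
  add_zero a := Subtype.ext <| by simp only [coe_mvAdd, coe_mvZero, add_zero, min_eq_left a.2.2]
  neg_neg a := Subtype.ext <| by simp only [coe_mvNeg, sub_sub_cancel]
  add_one a := Subtype.ext <| by
    simp only [coe_mvAdd, coe_mvNeg, coe_mvZero, sub_zero]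
    exact min_eq_right (by linarith [a.2.1])
  lukasiewicz a b := Subtype.ext <| by
    rw [coe_mvAdd_mvNeg_mvAdd_mvNeg, coe_mvAdd_mvNeg_mvAdd_mvNeg, max_comm]

variable {X : Type} {M : Type*} [mvLang.Structure M]

theorem fuzzy_funMap_apply {n : ℕ} (g : mvLang.Functions n) (v : Fin n → X → unitInterval) (x : X) :
    Structure.funMap g v x = Structure.funMap g fun i => v i x := by
  cases g <;> rfl

/-- The evaluation of fuzzy sets at a point. -/
noncomputable def fuzzyEval (x : X) : (X → unitInterval) →[mvLang] unitInterval where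
  toFun f := f x
  map_fun' g v := fuzzy_funMap_apply g v x
  map_rel' r := r.elim

/-- The homomorphism into the algebra of fuzzy sets whose composition with the evaluation at `x` is
`k x`. -/
noncomputable def fuzzyPi (k : X → M →[mvLang] unitInterval) : M →[mvLang] (X → unitInterval) where
  toFun s x := k x s
  map_fun' g v := funext fun x =>
    ((k x).map_fun g v).trans (fuzzy_funMap_apply g (fun i x => k x (v i)) x).symm
  map_rel' r := r.elim

end UnitInterval

namespace IsMVAlgebra

variable {M : Type*} [mvLang.Structure M]

theorem neg_add_self (h : IsMVAlgebra M) (x : M) : mvAdd (mvNeg x) x = mvNeg (mvZero M) := by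
  have := h.lukasiewicz x (mvNeg (mvZero M))
  rw [h.add_one, h.neg_neg, h.add_comm (mvZero M) x, h.add_zero] at this
  exact this.symm

theorem zero_add (h : IsMVAlgebra M) (x : M) : mvAdd (mvZero M) x = x := by
  rw [h.add_comm, h.add_zero]

theorem neg_add_eq_one_iff (h : IsMVAlgebra M) (x y : M) :
    mvAdd (mvNeg x) y = mvNeg (mvZero M) ↔ ∃ z, y = mvAdd x z := by
  constructor
  · intro hxy
    refine ⟨mvNeg (mvAdd (mvNeg y) x), ?_⟩
    have := h.lukasiewicz x y
    rw [hxy, h.neg_neg, h.zero_add] at this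
    rw [h.add_comm x, ← this]
  · rintro ⟨z, rfl⟩
    rw [h.add_assoc, h.neg_add_self, h.add_comm, h.add_one]

section Order

variable [hM : Fact (IsMVAlgebra M)]

/-- The additive monoid of an MV-algebra. -/
local instance addCommMonoid : AddCommMonoid M where
  add := mvAdd
  zero := mvZero M
  add_assoc x y z := (hM.out.add_assoc x y z).symm
  add_comm := hM.out.add_comm
  zero_add := hM.out.zero_add
  add_zero := hM.out.add_zero
  nsmul n x := (mvAdd · x)^[n] (mvZero M)
  nsmul_zero _ := rfl
  nsmul_succ n _ := Function.iterate_succ_apply' _ n _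

/-- The truncated subtraction `x ⊖ y = ¬(¬x ⊕ y)` of an MV-algebra. -/
local instance sub : Sub M where
  sub x y := mvNeg (mvAdd (mvNeg x) y)

/-- The natural order of an MV-algebra. -/
local instance partialOrder : PartialOrder M where
  le x y := mvAdd (mvNeg x) y = mvNeg (mvZero M)
  le_refl := hM.out.neg_add_self
  le_trans x y z hxy hyz := by
    rw [hM.out.neg_add_eq_one_iff] at *
    obtain ⟨a, rfl⟩ := hxy
    obtain ⟨b, rfl⟩ := hyz
    exact ⟨mvAdd a b, (hM.out.add_assoc _ _ _).symm⟩
  le_antisymm x y hxy hyx := by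
    have := hM.out.lukasiewicz x y
    rw [hxy, hyx, hM.out.neg_neg, hM.out.zero_add, hM.out.zero_add] at this
    exact this.symm

/-- The greatest element `¬0` of an MV-algebra. -/
local instance orderTop : OrderTop M where
  top := mvNeg (mvZero M)
  le_top x := hM.out.add_one (mvNeg x)

local instance canonicallyOrderedAdd : CanonicallyOrderedAdd M where
  exists_add_of_le h := (hM.out.neg_add_eq_one_iff _ _).1 h
  le_add_self _ y := (hM.out.neg_add_eq_one_iff _ _).2 ⟨y, hM.out.add_comm _ _⟩
  le_self_add _ y := (hM.out.neg_add_eq_one_iff _ _).2 ⟨y, rfl⟩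

local instance orderedSub : OrderedSub M where
  tsub_le_iff_right x y z := by
    change mvAdd (mvNeg (mvNeg (mvAdd (mvNeg x) y))) z = _ ↔ mvAdd (mvNeg x) (mvAdd z y) = _
    rw [hM.out.neg_neg, hM.out.add_comm z y, hM.out.add_assoc]

theorem top_sub_eq_mvNeg (x : M) : ⊤ - x = mvNeg x := by
  change mvNeg (mvAdd (mvNeg (mvNeg (mvZero M))) x) = mvNeg x
  rw [hM.out.neg_neg, hM.out.zero_add]

theorem involutive_top_sub : Function.Involutive fun x : M => ⊤ - x := fun x => by
  simp only [top_sub_eq_mvNeg, hM.out.neg_neg]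

variable [Finite M] {e : M}

/-- The homomorphism to `[0,1]` attached to an atom `e` of a finite MV-algebra. -/
noncomputable def heightHom (he : 0 ⋖ e) : M →[mvLang] unitInterval :=
  have hpos : (saturationIndex e : ℝ) ≠ 0 := Nat.cast_ne_zero.2 (saturationIndex_pos he.lt).ne'
  mvHom (normalizedHeight e)
    (fun x y => Subtype.ext <| by
      have hadd : nsmulHeight e (mvAdd x y) = _ := nsmulHeight_add he x y
      rw [coe_mvAdd, coe_normalizedHeight, coe_normalizedHeight, coe_normalizedHeight, hadd,
        ← add_div, ← div_self hpos, min_div_div_right (Nat.cast_nonneg _)]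
      push_cast
      rfl)
    (fun x => Subtype.ext <| by
      rw [coe_mvNeg, coe_normalizedHeight, coe_normalizedHeight, ← top_sub_eq_mvNeg,
        nsmulHeight_top_sub involutive_top_sub he, Nat.cast_sub (nsmulHeight_le e x), sub_div,
        div_self hpos])
    (Subtype.ext <| by
      have hzero : nsmulHeight e (mvZero M) = 0 := nsmulHeight_zero e
      rw [coe_mvZero, coe_normalizedHeight, hzero, Nat.cast_zero, zero_div])

theorem coe_heightHom (he : 0 ⋖ e) (x : M) :
    (heightHom he x : ℝ) = nsmulHeight e x / saturationIndex e := rfl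

theorem exists_rational_hom_ne_of_sub_ne_zero {x y : M} (hxy : x - y ≠ 0) :
    ∃ φ : M →[mvLang] unitInterval, (∀ z, ∃ r : ℚ, (φ z : ℝ) = r) ∧ φ x ≠ φ y := by
  obtain ⟨e, he, hexy⟩ := exists_covBy_le_of_lt (pos_of_ne_zero hxy)
  refine ⟨heightHom he, fun z => ⟨nsmulHeight e z / saturationIndex e, by
    rw [coe_heightHom]; push_cast; rfl⟩, fun heq => ?_⟩
  have hzero : heightHom he (x - y) = mvZero unitInterval := by
    change heightHom he (mvNeg (mvAdd (mvNeg x) y)) = _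
    rw [map_mvNeg, map_mvAdd, map_mvNeg, heq, isMVAlgebra_unitInterval.neg_add_self,
      isMVAlgebra_unitInterval.neg_neg]
  have hpos : (0 : ℝ) < heightHom he (x - y) :=
    div_pos (Nat.cast_pos.2 (nsmulHeight_pos he.lt hexy))
      (Nat.cast_pos.2 (saturationIndex_pos he.lt))
  rw [hzero, coe_mvZero] at hpos
  exact hpos.false

omit hM in
theorem exists_rational_hom_ne (h : IsMVAlgebra M) {x y : M} (hxy : x ≠ y) :
    ∃ φ : M →[mvLang] unitInterval, (∀ z, ∃ r : ℚ, (φ z : ℝ) = r) ∧ φ x ≠ φ y := by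
  have : Fact (IsMVAlgebra M) := ⟨h⟩
  by_cases hle : x ≤ y
  · have hyx : y - x ≠ 0 := fun h0 => hxy (hle.antisymm (tsub_eq_zero_iff_le.1 h0))
    obtain ⟨φ, hφ, hne⟩ := exists_rational_hom_ne_of_sub_ne_zero hyx
    exact ⟨φ, hφ, hne.symm⟩
  · exact exists_rational_hom_ne_of_sub_ne_zero (mt tsub_eq_zero_iff_le.1 hle)

end Order

end IsMVAlgebra

section UnitIntervalHoms

variable {M : Type*} [mvLang.Structure M] {φ ψ : M →[mvLang] unitInterval}

theorem map_mvZero_eq_zero (φ : M →[mvLang] unitInterval) : φ (mvZero M) = 0 :=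
  map_mvZero φ

theorem map_mvNeg_mvZero_eq_one (φ : M →[mvLang] unitInterval) : φ (mvNeg (mvZero M)) = 1 := by
  rw [map_mvNeg, map_mvZero]
  exact unitInterval.symm_zero

theorem exists_map_eq_projIcc (n : ℕ) (m : ℤ) (s : M) :
    ∃ d : M, ∀ φ : M →[mvLang] unitInterval,
      φ d = Set.projIcc 0 1 zero_le_one (n * φ s - m : ℝ) := by
  induction n generalizing m with
  | zero =>
    rcases le_or_gt 0 m with hm | hm
    · have hm' : (0 : ℝ) ≤ m := by exact_mod_cast hm
      refine ⟨mvZero M, fun φ => ?_⟩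
      rw [map_mvZero_eq_zero, Set.projIcc_of_le_left _ (by simpa using hm')]
      rfl
    · have hm' : (m : ℝ) ≤ -1 := by exact_mod_cast Int.le_sub_one_of_lt hm
      refine ⟨mvNeg (mvZero M), fun φ => ?_⟩
      rw [map_mvNeg_mvZero_eq_one,
        Set.projIcc_of_right_le _ (by simpa using le_neg_of_le_neg hm')]
      rfl
  | succ n ih =>
    obtain ⟨a, ha⟩ := ih m
    obtain ⟨b, hb⟩ := ih (m - 1)
    -- On `[0,1]` the term below is `max 0 (min 1 (a + s) + b - 1)`.
    refine ⟨mvNeg (mvAdd (mvNeg (mvAdd a s)) (mvNeg b)), fun φ => Subtype.ext ?_⟩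
    have hs := (φ s).2
    simp only [map_mvNeg, map_mvAdd, coe_mvNeg, coe_mvAdd, ha, hb, Set.coe_projIcc]
    push_cast
    grind

theorem exists_map_eq_zero_one_of_lt {s : M} (hs : φ s < ψ s) : ∃ d, φ d = 0 ∧ ψ d = 1 := by
  have hpos : (0 : ℝ) < ψ s - φ s := sub_pos.2 hs
  obtain ⟨n, hn⟩ := exists_nat_ge (2 / (ψ s - φ s : ℝ))
  rw [div_le_iff₀ hpos] at hn
  obtain ⟨d, hd⟩ := exists_map_eq_projIcc n ⌈(n * φ s : ℝ)⌉ s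
  refine ⟨d, ?_, ?_⟩
  · exact (hd φ).trans (Set.projIcc_of_le_left _ (sub_nonpos.2 (Int.le_ceil _)))
  · refine (hd ψ).trans (Set.projIcc_of_right_le _ ?_)
    linarith [Int.ceil_lt_add_one (n * φ s : ℝ)]

theorem exists_map_eq_zero_one_of_ne (h : φ ≠ ψ) : ∃ d, φ d = 0 ∧ ψ d = 1 := by
  obtain ⟨s, hs⟩ := DFunLike.ne_iff.1 h
  rcases hs.lt_or_gt with hlt | hgt
  · exact exists_map_eq_zero_one_of_lt hlt
  · refine exists_map_eq_zero_one_of_lt (s := mvNeg s) ?_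
    rw [map_mvNeg, map_mvNeg]
    exact sub_lt_sub_left (show (ψ s : ℝ) < φ s from hgt) 1

theorem exists_map_eq_zero_forall_map_le [Finite M] (φ : M →[mvLang] unitInterval) :
    ∃ d, φ d = 0 ∧ ∀ c, φ c = 0 → ∀ ψ : M →[mvLang] unitInterval, ψ c ≤ ψ d := by
  have : Nonempty {c // φ c = 0} := ⟨⟨mvZero M, map_mvZero_eq_zero φ⟩⟩
  have hdir : Directed (· ≤ ·) fun (c : {c // φ c = 0}) (ψ : M →[mvLang] unitInterval) => ψ c := by
    rintro ⟨a, ha⟩ ⟨b, hb⟩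
    refine ⟨⟨mvAdd a b, Subtype.ext ?_⟩, fun ψ => ?_, fun ψ => ?_⟩
    · rw [map_mvAdd, coe_mvAdd, ha, hb]
      simp
    · exact (map_mvAdd ψ a b).ge.trans' (le_min (le_add_of_nonneg_right (ψ b).2.1) (ψ a).2.2)
    · exact (map_mvAdd ψ a b).ge.trans' (le_min (le_add_of_nonneg_left (ψ a).2.1) (ψ b).2.2)
  obtain ⟨⟨d, hd⟩, hle⟩ := hdir.finite_le id
  exact ⟨d, hd, fun c hc => hle ⟨c, hc⟩⟩

theorem surjective_of_injective_eval [Finite M] {ι : Type*} {k : ι → M →[mvLang] unitInterval}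
    (hk : Function.Injective fun x i => k i x) : Function.Surjective k := by
  intro φ
  by_contra! hne
  obtain ⟨d, hd, hle⟩ := exists_map_eq_zero_forall_map_le φ
  have hd1 : d = mvNeg (mvZero M) := hk <| funext fun i => by
    obtain ⟨c, hc0, hc1⟩ := exists_map_eq_zero_one_of_ne (hne i).symm
    have hkd : k i d = 1 := unitInterval.le_one'.antisymm (hc1.ge.trans (hle c hc0 (k i)))
    exact hkd.trans (map_mvNeg_mvZero_eq_one (k i)).symm
  rw [hd1, map_mvNeg_mvZero_eq_one] at hd
  exact one_ne_zero hd

end UnitIntervalHoms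

namespace IsMVAlgebra

variable {M N : Type*} [mvLang.Structure M] [mvLang.Structure N]

theorem exists_rational_homs_eval_injective (h : IsMVAlgebra N) [Finite N] :
    ∃ k : {p : N × N // p.1 ≠ p.2} → N →[mvLang] unitInterval,
      (∀ p s, ∃ r : ℚ, (k p s : ℝ) = r) ∧ Function.Injective fun s p => k p s := by
  choose k hrat hne using fun p : {p : N × N // p.1 ≠ p.2} => h.exists_rational_hom_ne p.2
  exact ⟨k, hrat, fun s t hst => by_contra fun hst' => hne ⟨(s, t), hst'⟩ (congrFun hst _)⟩

theorem exists_rat_eq_hom_apply (h : IsMVAlgebra N) [Finite N] (φ : N →[mvLang] unitInterval)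
    (s : N) : ∃ r : ℚ, (φ s : ℝ) = r := by
  obtain ⟨k, hrat, hk⟩ := h.exists_rational_homs_eval_injective
  obtain ⟨p, rfl⟩ := surjective_of_injective_eval hk φ
  exact hrat p s

theorem finite_hom_unitInterval (h : IsMVAlgebra N) [Finite N] :
    Finite (N →[mvLang] unitInterval) :=
  let ⟨_, _, hk⟩ := h.exists_rational_homs_eval_injective
  Finite.of_surjective _ (surjective_of_injective_eval hk)

theorem eval_injective (h : IsMVAlgebra N) [Finite N] :
    Function.Injective fun (s : N) (φ : N →[mvLang] unitInterval) => φ s := by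
  intro s t hst
  by_contra hne
  obtain ⟨φ, -, hφ⟩ := h.exists_rational_hom_ne hne
  exact hφ (congrFun hst φ)

theorem comp_surjective (h : IsMVAlgebra N) [Finite N] (i : M ↪[mvLang] N) :
    Function.Surjective fun φ : N →[mvLang] unitInterval => φ.comp i.toHom :=
  have : Finite M := Finite.of_injective i i.injective
  surjective_of_injective_eval (h.eval_injective.comp i.injective)

theorem nonempty_hom_unitInterval (h : IsMVAlgebra N) [Finite N] [Nontrivial N] :
    Nonempty (N →[mvLang] unitInterval) :=
  let ⟨_, _, hne⟩ := exists_pair_ne N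
  let ⟨φ, _⟩ := h.exists_rational_hom_ne hne
  ⟨φ⟩

end IsMVAlgebra

section LocallyConstant

variable {X R Q : Type*} [TopologicalSpace X]

theorem isLocallyConstant_pi {ι β : Type*} [Finite ι] {k : X → ι → β}
    (hk : ∀ i, IsLocallyConstant fun x => k x i) : IsLocallyConstant k :=
  (LocallyConstant.unflip fun i => ⟨_, hk i⟩).isLocallyConstant

theorem exists_isLocallyConstant_leftInverse [TotallySeparatedSpace X] [Finite R] [Nonempty R]
    {y : R → X} (hy : Function.Injective y) :
    ∃ k : X → R, IsLocallyConstant k ∧ Function.LeftInverse k y := by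
  choose U hU hmem hnotMem using fun p : {p : R × R // p.1 ≠ p.2} =>
    exists_isClopen_of_totally_separated (hy.ne p.2)
  classical
  let δ : X → {p : R × R // p.1 ≠ p.2} → Fin 2 := fun x p => LocallyConstant.ofIsClopen (hU p) x
  have hδ : IsLocallyConstant δ := isLocallyConstant_pi fun p => LocallyConstant.isLocallyConstant _
  have hδy : Function.Injective (δ ∘ y) := fun a b hab => by_contra fun hne =>
    hnotMem ⟨(a, b), hne⟩ <| by
      simpa [δ, LocallyConstant.ofIsClopen, hmem ⟨(a, b), hne⟩] using congrFun hab ⟨(a, b), hne⟩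
  exact ⟨Function.invFun (δ ∘ y) ∘ δ, hδ.comp _, Function.leftInverse_invFun hδy⟩

theorem exists_isLocallyConstant_surjOn_univ [TotallySeparatedSpace X] [Finite R] [Nonempty R]
    {U : Set X} (hU : U.Infinite) :
    ∃ k : X → R, IsLocallyConstant k ∧ Set.SurjOn k U Set.univ := by
  have := hU.to_subtype
  obtain ⟨f⟩ := nonempty_embedding_nat R
  let y : R ↪ U := f.trans (Infinite.natEmbedding U)
  obtain ⟨k, hk, hky⟩ := exists_isLocallyConstant_leftInverse
    (Subtype.val_injective.comp y.injective)
  exact ⟨k, hk, fun a _ => ⟨y a, (y a).2, hky a⟩⟩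

theorem exists_isLocallyConstant_surjective_lift [PerfectSpace X] [TotallySeparatedSpace X]
    [Finite R] {q : X → Q} (hq : IsLocallyConstant q) (hqsurj : Function.Surjective q)
    {r : R → Q} (hr : Function.Surjective r) :
    ∃ k : X → R, IsLocallyConstant k ∧ Function.Surjective k ∧ r ∘ k = q := by
  have hfibre (a : Q) : (q ⁻¹' {a}).Infinite := by
    obtain ⟨x, rfl⟩ := hqsurj a
    exact infinite_of_mem_nhds x ((hq.isOpen_fiber _).mem_nhds rfl)
  have hne (a : Q) : Nonempty {b // r b = a} := nonempty_subtype.2 (hr a)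
  choose κ hκ hκsurj using fun a =>
    exists_isLocallyConstant_surjOn_univ (R := {b // r b = a}) (hfibre a)
  refine ⟨fun x => κ (q x) x, ?_, fun b => ?_, funext fun x => (κ (q x) x).2⟩
  · rw [IsLocallyConstant.iff_eventually_eq]
    intro x
    filter_upwards [hq.eventually_eq x, (hκ (q x)).eventually_eq x] with z hqz hκz
    rw [hqz, hκz]
  · obtain ⟨x, hx, hxb⟩ := hκsurj (r b) (Set.mem_univ ⟨b, rfl⟩)
    rw [Set.mem_preimage, Set.mem_singleton_iff] at hx
    exact ⟨x, by beta_reduce; rw [hx, hxb]⟩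

end LocallyConstant

section CantorSet

theorem perfectSpace_pi {ι : Type*} [Infinite ι] {X : ι → Type*} [∀ i, TopologicalSpace (X i)]
    [∀ i, Nontrivial (X i)] : PerfectSpace (∀ i, X i) := by
  classical
  rw [perfectSpace_iff_forall_not_isolated]
  intro x
  choose z hz using fun i => exists_ne (x i)
  have ht : Filter.Tendsto (fun i => Function.update x i (z i)) Filter.cofinite (nhds x) :=
    tendsto_pi_nhds.2 fun j => tendsto_const_nhds.congr' <| by
      filter_upwards [(Set.finite_singleton j).compl_mem_cofinite] with i hi
      rw [Function.update_of_ne (Ne.symm hi)]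
  have hne (i : ι) : Function.update x i (z i) ∈ ({x} : Set (∀ i, X i))ᶜ := fun hi =>
    hz i (by simpa using congrFun hi i)
  exact (tendsto_nhdsWithin_iff.2 ⟨ht, Filter.Eventually.of_forall hne⟩).neBot

theorem perfectSpace_iff_forall_not_isOpen_singleton {X : Type*} [TopologicalSpace X] :
    PerfectSpace X ↔ ∀ x : X, ¬IsOpen {x} := by
  simp only [perfectSpace_iff_forall_not_isolated, Filter.neBot_iff,
    isOpen_singleton_iff_punctured_nhds, ne_eq]

theorem perfectSpace_of_isOpenEmbedding {X Y : Type*} [TopologicalSpace X] [TopologicalSpace Y]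
    [PerfectSpace Y] {f : X → Y} (hf : Topology.IsOpenEmbedding f) : PerfectSpace X := by
  rw [perfectSpace_iff_forall_not_isOpen_singleton]
  intro x hx
  refine perfectSpace_iff_forall_not_isOpen_singleton.1 ‹PerfectSpace Y› (f x) ?_
  simpa only [Set.image_singleton] using hf.isOpenMap _ hx

instance perfectSpace_cantorSet : PerfectSpace cantorSet :=
  have := perfectSpace_pi (X := fun _ : ℕ => Bool)
  perfectSpace_of_isOpenEmbedding cantorSetHomeomorphNatToBool.isOpenEmbedding

instance compactSpace_cantorSet : CompactSpace cantorSet :=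
  isCompact_iff_compactSpace.1 isCompact_cantorSet

instance totallySeparatedSpace_cantorSet : TotallySeparatedSpace cantorSet :=
  have := cantorSetHomeomorphNatToBool.symm.totallyDisconnectedSpace
  inferInstance

instance nonempty_cantorSet : Nonempty cantorSet := ⟨⟨0, zero_mem_cantorSet⟩⟩

end CantorSet

section StepAlgebra

/-- The evaluation of elements of `stepAlgebra` at a point of the Cantor set. -/
noncomputable def stepEval (x : cantorSet) : stepAlgebra →[mvLang] unitInterval :=
  (fuzzyEval x).comp stepAlgebra.subtype.toHom

theorem stepEval_injective : Function.Injective fun (f : stepAlgebra) x => stepEval x f :=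
  Subtype.val_injective

theorem isLocallyConstant_stepEval (f : stepAlgebra) : IsLocallyConstant fun x => stepEval x f :=
  ((mem_stepFuzzySets_iff _).1 f.2).1

theorem exists_rat_eq_stepEval (f : stepAlgebra) (x : cantorSet) :
    ∃ r : ℚ, (stepEval x f : ℝ) = r :=
  ((mem_stepFuzzySets_iff _).1 f.2).2 x

theorem isMVAlgebra_stepAlgebra : IsMVAlgebra stepAlgebra :=
  isMVAlgebra_unitInterval.of_injective stepEval stepEval_injective

theorem infinite_stepAlgebra : Infinite stepAlgebra := by
  let const (q : Set.Icc (0 : ℚ) 1) : stepAlgebra :=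
    ⟨fun _ => ⟨(q : ℚ), by exact_mod_cast q.2.1, by exact_mod_cast q.2.2⟩,
      (mem_stepFuzzySets_iff _).2 ⟨IsLocallyConstant.const _, fun _ => ⟨q, rfl⟩⟩⟩
  have := (Set.Icc_infinite (zero_lt_one' ℚ)).to_subtype
  refine Infinite.of_injective const fun p q h => Subtype.ext (Rat.cast_injective (α := ℝ) ?_)
  exact congrArg (fun f => (stepEval (Classical.arbitrary cantorSet) f : ℝ)) h

instance countable_stepAlgebra : Countable stepAlgebra := by
  let Q := {q : unitInterval | ∃ r : ℚ, (q : ℝ) = r}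
  have hsubset : Q ⊆ Subtype.val ⁻¹' Set.range ((↑) : ℚ → ℝ) := fun _ ⟨r, hr⟩ => ⟨r, hr.symm⟩
  have : Countable Q :=
    (((Set.countable_range _).preimage Subtype.val_injective).mono hsubset).to_subtype
  have : Countable (TopologicalSpace.Clopens cantorSet) :=
    TopologicalSpace.Clopens.countable_iff_secondCountable.2 inferInstance
  let join (p : Σ n : ℕ, (Fin n → Q) × (Fin n → TopologicalSpace.Clopens cantorSet)) :
      cantorSet → unitInterval :=
    Finset.univ.sup fun i => (p.2.2 i : Set cantorSet).indicator fun _ => (p.2.1 i : unitInterval)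
  have hjoin : stepFuzzySets ⊆ Set.range join := by
    rintro f ⟨n, q, U, h, rfl⟩
    exact ⟨⟨n, fun i => ⟨q i, (h i).1⟩, fun i => ⟨U i, (h i).2⟩⟩, rfl⟩
  exact ((Set.countable_range join).mono hjoin).to_subtype

variable {M N : Type*} [mvLang.Structure M] [mvLang.Structure N]

theorem isLocallyConstant_stepEval_comp [Finite N] (f : N →[mvLang] stepAlgebra) :
    IsLocallyConstant fun x => (stepEval x).comp f :=
  IsLocallyConstant.desc _ (fun φ : N →[mvLang] unitInterval => (φ : N → unitInterval))
    (isLocallyConstant_pi fun s => isLocallyConstant_stepEval (f s)) DFunLike.coe_injective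

theorem surjective_stepEval_comp [Finite N] (f : N ↪[mvLang] stepAlgebra) :
    Function.Surjective fun x => (stepEval x).comp f.toHom :=
  surjective_of_injective_eval (stepEval_injective.comp f.injective)

theorem exists_embedding_stepEval_comp_eq (h : IsMVAlgebra N) [Finite N]
    {k : cantorSet → N →[mvLang] unitInterval} (hk : IsLocallyConstant k)
    (hsurj : Function.Surjective k) :
    ∃ f : N ↪[mvLang] stepAlgebra, ∀ x, (stepEval x).comp f.toHom = k x := by
  have hinj : Function.Injective (fuzzyPi k) := fun s t hst => h.eval_injective <|
    funext <| hsurj.forall.2 fun x => congrFun hst x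
  have hmem (s : N) : fuzzyPi k s ∈ stepAlgebra :=
    (mem_stepFuzzySets_iff _).2 ⟨hk.comp fun φ => φ s, fun x => h.exists_rat_eq_hom_apply (k x) s⟩
  exact ⟨(Embedding.ofInjective hinj).codRestrict stepAlgebra hmem, fun _ => rfl⟩

theorem exists_embedding_comp_eq (h : IsMVAlgebra N) [Finite N] (i : M ↪[mvLang] N)
    (f : M ↪[mvLang] stepAlgebra) : ∃ f' : N ↪[mvLang] stepAlgebra, f'.comp i = f := by
  have : Finite M := Finite.of_injective i i.injective
  have := h.finite_hom_unitInterval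
  obtain ⟨k, hk, hsurj, hlift⟩ := exists_isLocallyConstant_surjective_lift
    (isLocallyConstant_stepEval_comp f.toHom) (surjective_stepEval_comp f) (h.comp_surjective i)
  obtain ⟨f', hf'⟩ := exists_embedding_stepEval_comp_eq h hk hsurj
  refine ⟨f', Embedding.ext fun s => stepEval_injective <| funext fun x => ?_⟩
  calc stepEval x (f' (i s)) = k x (i s) := DFunLike.congr_fun (hf' x) (i s)
    _ = stepEval x (f s) := DFunLike.congr_fun (congrFun hlift x) s

theorem nonempty_embedding_stepAlgebra (h : IsMVAlgebra N) [Finite N] [Nontrivial N] :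
    Nonempty (N ↪[mvLang] stepAlgebra) := by
  have := h.finite_hom_unitInterval
  have := h.nonempty_hom_unitInterval
  obtain ⟨k, hk, hsurj⟩ := exists_isLocallyConstant_surjOn_univ (R := N →[mvLang] unitInterval)
    (infinite_of_mem_nhds (Classical.arbitrary cantorSet) Filter.univ_mem)
  obtain ⟨f, -⟩ := exists_embedding_stepEval_comp_eq h hk (Set.surjOn_univ.1 hsurj)
  exact ⟨f⟩

end StepAlgebra

section LocallyFinite

/-- The finite chain `{0, 1/n, …, 1}`, as a subalgebra of `[0,1]`. For `n = 0` the condition is void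
and this is all of `[0,1]`. -/
def lukasiewiczChain (n : ℕ) : mvLang.Substructure unitInterval where
  carrier := {u | ∃ k : ℤ, (u : ℝ) * n = k}
  fun_mem g v hv := by
    cases g with
    | oplus =>
      obtain ⟨k, hk⟩ := hv 0
      obtain ⟨l, hl⟩ := hv 1
      refine ⟨min (k + l) n, ?_⟩
      rw [funMap_oplus, coe_mvAdd, min_mul_of_nonneg _ _ n.cast_nonneg, add_mul, hk, hl, one_mul]
      push_cast
      rfl
    | neg =>
      obtain ⟨k, hk⟩ := hv 0
      refine ⟨n - k, ?_⟩
      rw [funMap_neg, coe_mvNeg, sub_mul, hk, one_mul]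
      push_cast
      rfl
    | zero => exact ⟨0, by rw [funMap_zero, coe_mvZero, zero_mul, Int.cast_zero]⟩

theorem finite_lukasiewiczChain {n : ℕ} (hn : 0 < n) :
    (lukasiewiczChain n : Set unitInterval).Finite := by
  have hn' : (0 : ℝ) < n := Nat.cast_pos.2 hn
  refine ((Set.finite_Icc (0 : ℤ) n).image
    fun k : ℤ => Set.projIcc (0 : ℝ) 1 zero_le_one (k / n)).subset ?_
  rintro u ⟨k, hk⟩
  refine ⟨k, ⟨?_, ?_⟩, ?_⟩
  · exact_mod_cast hk ▸ mul_nonneg u.2.1 hn'.le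
  · exact_mod_cast hk ▸ mul_le_of_le_one_left hn'.le u.2.2
  · beta_reduce
    rw [← hk, mul_div_cancel_right₀ _ hn'.ne', Set.projIcc_val]

theorem lukasiewiczChain_mono {m n : ℕ} (h : m ∣ n) :
    lukasiewiczChain m ≤ lukasiewiczChain n := by
  obtain ⟨l, rfl⟩ := h
  rintro u ⟨k, hk⟩
  exact ⟨k * l, by push_cast; rw [← hk, mul_assoc]⟩

theorem mem_lukasiewiczChain_den {u : unitInterval} {r : ℚ} (hr : (u : ℝ) = r) :
    u ∈ lukasiewiczChain r.den :=
  ⟨r.num, by rw [hr]; exact_mod_cast r.mul_den_eq_num⟩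

theorem exists_subset_lukasiewiczChain {V : Set unitInterval} (hV : V.Finite)
    (hrat : ∀ u ∈ V, ∃ r : ℚ, (u : ℝ) = r) : ∃ n, 0 < n ∧ V ⊆ lukasiewiczChain n := by
  choose! r hr using hrat
  refine ⟨∏ u ∈ hV.toFinset, (r u).den, Finset.prod_pos fun u _ => (r u).den_pos, fun u hu => ?_⟩
  exact lukasiewiczChain_mono (Finset.dvd_prod_of_mem (fun u => (r u).den) (hV.mem_toFinset.2 hu))
    (mem_lukasiewiczChain_den (hr u hu))

theorem finite_iInf_comap_fuzzyEval {ι : Type} [Finite ι] {B : mvLang.Substructure unitInterval}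
    (hB : (B : Set unitInterval).Finite) :
    ((⨅ i : ι, B.comap (fuzzyEval i) : mvLang.Substructure (ι → unitInterval)) :
      Set (ι → unitInterval)).Finite :=
  (Set.Finite.pi' fun _ : ι => hB).subset fun _ hf i => Substructure.mem_iInf.1 hf i

theorem finite_of_fg_stepAlgebra (S : mvLang.Substructure stepAlgebra) (hS : S.FG) : Finite S := by
  obtain ⟨F, rfl⟩ := hS
  let δ : cantorSet → F → unitInterval := fun x a => stepEval x a
  have hδ : (Set.range δ).Finite :=
    (isLocallyConstant_pi fun a : F => isLocallyConstant_stepEval a.1).range_finite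
  have : Finite (Set.range δ) := hδ
  obtain ⟨n, hn, hden⟩ := exists_subset_lukasiewiczChain
    (V := ⋃ a : F, Set.range fun x => stepEval x a)
    (Set.finite_iUnion fun a => (isLocallyConstant_stepEval a.1).range_finite) <| by
      simp only [Set.mem_iUnion, Set.mem_range]
      rintro _ ⟨a, x, rfl⟩
      exact exists_rat_eq_stepEval a.1 x
  -- The functions factoring through `δ` with values of denominator `n` form a finite subalgebra.
  let factors : (Set.range δ → unitInterval) →[mvLang] (cantorSet → unitInterval) :=
    fuzzyPi fun x => fuzzyEval (Set.rangeFactorization δ x)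
  let T : mvLang.Substructure (Set.range δ → unitInterval) :=
    ⨅ i, (lukasiewiczChain n).comap (fuzzyEval i)
  have hT : (T.map factors : Set (cantorSet → unitInterval)).Finite :=
    (finite_iInf_comap_fuzzyEval (finite_lukasiewiczChain hn)).image factors
  have hle : Substructure.closure mvLang (F : Set stepAlgebra) ≤
      (T.map factors).comap stepAlgebra.subtype.toHom := by
    rw [Substructure.closure_le]
    intro a ha
    refine ⟨fun i => i.1 ⟨a, ha⟩, Substructure.mem_iInf.2 ?_, rfl⟩
    rintro ⟨_, x, rfl⟩
    exact hden (Set.mem_iUnion.2 ⟨⟨a, ha⟩, x, rfl⟩)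
  exact ((hT.preimage Subtype.val_injective.injOn).subset hle).to_subtype

end LocallyFinite

section FraisseLimit

variable {M : Type u} [mvLang.Structure M]

theorem fg_and_nonempty_embedding_stepAlgebra_iff :
    Structure.FG mvLang M ∧ Nonempty (M ↪[mvLang] stepAlgebra) ↔
      IsMVAlgebra M ∧ Finite M ∧ Nontrivial M := by
  constructor
  · rintro ⟨hM, ⟨f⟩⟩
    have := finite_of_fg_stepAlgebra _ (hM.range f.toHom)
    let eval (x : cantorSet) : M →[mvLang] unitInterval := (stepEval x).comp f.toHom
    refine ⟨isMVAlgebra_unitInterval.of_injective eval (stepEval_injective.comp f.injective),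
      Finite.of_equiv _ f.equivRange.symm.toEquiv, mvZero M, mvNeg (mvZero M), fun h => ?_⟩
    have h01 := congrArg (eval (Classical.arbitrary cantorSet)) h
    rw [map_mvZero_eq_zero, map_mvNeg_mvZero_eq_one] at h01
    exact zero_ne_one h01
  · rintro ⟨h, _, _⟩
    exact ⟨Structure.FG.of_finite, nonempty_embedding_stepAlgebra h⟩

theorem age_eq_finiteMVAlgebras (e : M ≃[mvLang] stepAlgebra) :
    mvLang.age M = finiteMVAlgebras.{u} := by
  ext N
  refine Iff.trans (and_congr_right fun _ => ?_) fg_and_nonempty_embedding_stepAlgebra_iff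
  exact ⟨fun ⟨f⟩ => ⟨e.toEmbedding.comp f⟩, fun ⟨f⟩ => ⟨e.symm.toEmbedding.comp f⟩⟩

theorem isUltrahomogeneous_of_equiv_stepAlgebra [Countable M] (e : M ≃[mvLang] stepAlgebra) :
    mvLang.IsUltrahomogeneous M := by
  rw [isUltrahomogeneous_iff_IsExtensionPair Structure.cg_of_countable,
    isExtensionPair_iff_exists_embedding_closure_singleton_sup]
  intro S hS f m
  let T := Substructure.closure mvLang {m} ⊔ S
  have hT : T.FG := (Substructure.fg_closure_singleton m).sup hS
  obtain ⟨hTmv, _, _⟩ := fg_and_nonempty_embedding_stepAlgebra_iff.1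
    ⟨(Substructure.fg_iff_structure_fg T).1 hT, ⟨e.toEmbedding.comp T.subtype⟩⟩
  obtain ⟨f', hf'⟩ := exists_embedding_comp_eq hTmv
    (Substructure.inclusion (le_sup_right : S ≤ T)) (e.toEmbedding.comp f)
  refine ⟨e.symm.toEmbedding.comp f', ?_⟩
  rw [Embedding.comp_assoc, hf']
  exact Embedding.ext fun s => (e.symm_apply_apply (f s)).symm

theorem isFraisseLimit_of_equiv_stepAlgebra [Countable M] (e : M ≃[mvLang] stepAlgebra) :
    IsFraisseLimit finiteMVAlgebras.{u} M :=
  ⟨isUltrahomogeneous_of_equiv_stepAlgebra e, age_eq_finiteMVAlgebras e⟩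

end FraisseLimit

theorem theorem4p9 :
    IsFraisse finiteMVAlgebras.{u} ∧
    IsMVAlgebra stepAlgebra ∧
    Infinite stepAlgebra ∧
    (∀ S : mvLang.Substructure stepAlgebra, S.FG → Finite S) ∧
    (∃ _ : Countable stepAlgebra, IsFraisseLimit finiteMVAlgebras.{0} stepAlgebra) ∧
    (∀ (M : Type u) [mvLang.Structure M] [Countable M],
      IsFraisseLimit finiteMVAlgebras.{u} M ↔ Nonempty (M ≃[mvLang] stepAlgebra)) := by
  let ι : stepAlgebra ≃ ULift.{u} stepAlgebra := _root_.Equiv.ulift.symm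
  let _ : mvLang.Structure (ULift.{u} stepAlgebra) := ι.inducedStructure
  let e : ULift.{u} stepAlgebra ≃[mvLang] stepAlgebra := ι.inducedStructureEquiv.symm
  have hlim := isFraisseLimit_of_equiv_stepAlgebra e
  refine ⟨hlim.isFraisse, isMVAlgebra_stepAlgebra, infinite_stepAlgebra, finite_of_fg_stepAlgebra,
    ⟨countable_stepAlgebra, isFraisseLimit_of_equiv_stepAlgebra (.refl mvLang stepAlgebra)⟩,
    fun M _ _ => ⟨fun hM => ?_, fun ⟨e'⟩ => isFraisseLimit_of_equiv_stepAlgebra e'⟩⟩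
  obtain ⟨g⟩ := hM.nonempty_equiv hlim
  exact ⟨e.comp g⟩
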